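/- Let $k$ be a field that is complete with respect to a non-Archimedean absolute value $|\cdot|\colon k\to[0,\infty)$ whose set of values $|k|$ is dense in $[0,\infty)$. Let $\kappa$ be either an infinite cardinal or the class of all cardinals (in the latter case "of cardinality less than $\kappa$" is no restriction). Assume the non-measurability condition: no set $X$ of cardinality less than $\kappa$ is $\omega_1$-measurable, where $X$ is called $\omega_1$-measurable if it is uncountable and carries a non-principal ultrafilter that is closed under countable intersections. For a family $(W_i)_{i\in I}$ of Banach $k$-vector spaces, let $\Pi_I W$ be its bounded direct product, that is, the space of all families $(w_i)_{i \in I}$ with $w_i\in W_i$ and $\sup_i\|w_i\|<\infty$, with the supremum norm, and let $\Sigma_I W\subset\Pi_I W$ be its completed direct sum, that is, the subspace of those $w$ for which $\{i\in I : \|w_i\|\ge\epsilon\}$ is finite for every $\epsilon>0$. Isomorphism of Banach $k$-vector spaces means isometric $k$-linear isomorphism. Define classes $\mathscr{R}_\alpha$ of Banach $k$-vector spaces by recursion on the ordinal $\alpha$: $\mathscr{R}_0$ consists of the spaces isomorphic to $k^n$ with the maximum norm for some integer $n\ge 0$; for $\alpha\ne0$, $\mathscr{R}_\alpha$ consists of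 the spaces isomorphic to $\Pi_I W$ or to $\Sigma_I W$ for some set $I$ of cardinality less than $\kappa$ and some family $(W_i)_{i\in I}$ each of whose members lies in $\bigcup_{\beta<\alpha}\mathscr{R}_\beta$. Put $\mathscr{R}=\bigcup_\alpha\mathscr{R}_\alpha$; it is the smallest class of Banach $k$-vector spaces that contains $k$ and is closed under isomorphism and under bounded direct products and completed direct sums indexed by sets of cardinality less than $\kappa$. **Theorem.** Suppose that $k$ is not spherically complete, i.e. that some decreasing sequence of closed balls of positive radius in $k$ has empty intersection. Let $C_{\mathrm{bd}}(\mathbb{Q},k)$ be the Banach $k$-vector space of bounded continuous functions $\mathbb{Q}\to k$ with the supremum norm, where $\mathbb{Q}$ has its usual topology, and let $C_{\mathrm{bd}}(\mathbb{Q},k)^\vee$ be its dual, the space of bounded $k$-linear functionals $C_{\mathrm{bd}}(\mathbb{Q},k)\to k$ with the operator norm. Then $C_{\mathrm{bd}}(\mathbb{Q},k)^\vee$ does not belong to $\mathscr{R}$. -/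

import Mathlib

open scoped ENNReal Cardinal BoundedContinuousFunction

universe u v

/-- A metric space is spherically complete if every decreasing sequence of closed balls of
positive radius has a common point. -/
def SphericallyComplete (X : Type v) [PseudoMetricSpace X] : Prop :=
  ∀ (c : ℕ → X) (r : ℕ → ℝ), (∀ n, 0 < r n) →
    Antitone (fun n => Metric.closedBall (c n) (r n)) →
    (⋂ n, Metric.closedBall (c n) (r n)).Nonempty

/-- A set `X` is `c`-measurable if it is uncountable and carries a `c`-complete non-principal
ultrafilter. -/
def CardinalMeasurable (c : Cardinal.{u}) (X : Type u) : Prop :=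
  Uncountable X ∧
    ∃ F : Ultrafilter X, CardinalInterFilter (F : Filter X) c ∧ ∀ x : X, F ≠ pure x

/-- No set of cardinality less than `κ` is `ω₁`-measurable. Here and below a bound `κ` on
cardinalities is either a cardinal or `⊤`, the latter meaning that there is no bound. -/
def NonMeasurabilityCondition (κ : WithTop Cardinal.{u}) : Prop :=
  ∀ X : Type u, ((#X : Cardinal.{u}) : WithTop Cardinal.{u}) < κ → ¬ CardinalMeasurable ℵ₁ X

section Sums

variable (k : Type v) [NormedField k] {I : Type u} (W : I → Type v)
  [∀ i, NormedAddCommGroup (W i)] [∀ i, NormedSpace k (W i)]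

/-- The bounded direct product of a family `W`: all families `w` with `w i ∈ W i` and
`sup ‖w i‖ < ∞`, with the supremum norm. -/
abbrev BoundedProduct {I : Type u} (W : I → Type v) [∀ i, NormedAddCommGroup (W i)] :
    Type (max u v) :=
  lp W ∞

/-- The completed direct sum of a family `W`: the subspace of the bounded direct product of
those `w` for which `{i | ε ≤ ‖w i‖}` is finite for every `ε > 0`. -/
def CompletedSum : Submodule k (BoundedProduct W) where
  carrier := {w | ∀ ε : ℝ, 0 < ε → {i | ε ≤ ‖w i‖}.Finite}
  zero_mem' := by
    intro ε hε
    refine Set.finite_empty.subset ?_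
    intro i hi
    have h : ε ≤ ‖(0 : W i)‖ := hi
    rw [norm_zero] at h
    exact absurd h (not_le.mpr hε)
  add_mem' := by
    intro a b ha hb ε hε
    refine ((ha (ε / 2) (half_pos hε)).union (hb (ε / 2) (half_pos hε))).subset ?_
    intro i hi
    have h : ε ≤ ‖a i + b i‖ := hi
    by_contra hcon
    have h1 : ‖a i‖ < ε / 2 := not_le.mp fun h' => hcon (Or.inl h')
    have h2 : ‖b i‖ < ε / 2 := not_le.mp fun h' => hcon (Or.inr h')
    have h3 := norm_add_le (a i) (b i)
    linarith
  smul_mem' := by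
    intro c a ha ε hε
    refine (ha (ε / (‖c‖ + 1)) (by positivity)).subset ?_
    intro i hi
    have h : ε ≤ ‖c • a i‖ := hi
    rw [norm_smul] at h
    show ε / (‖c‖ + 1) ≤ ‖a i‖
    rw [div_le_iff₀ (by positivity)]
    nlinarith [norm_nonneg (a i), norm_nonneg c]

end Sums

/-- The Reid hierarchy over `k` with respect to `κ`: `ReidHierarchy k κ α V` says that `V` is a
member of its `α`-th level. Level `0` consists of the spaces isometrically isomorphic to `k ^ n`
(with the maximum norm) for some `n`. For `α ≠ 0`, the `α`-th level consists of the spaces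
isometrically isomorphic to the bounded direct product, or to the completed direct sum, of a
family of spaces of levels less than `α` that is indexed by a set of cardinality less than `κ`. -/
inductive ReidHierarchy (k : Type u) [NormedField k] (κ : WithTop Cardinal.{u}) :
    Ordinal.{u} → ∀ (V : Type u) [NormedAddCommGroup V] [NormedSpace k V], Prop
  | zero (V : Type u) [NormedAddCommGroup V] [NormedSpace k V] (n : ℕ)
      (e : V ≃ₗᵢ[k] (Fin n → k)) : ReidHierarchy k κ 0 V
  | prod (α : Ordinal.{u}) (V : Type u) [NormedAddCommGroup V] [NormedSpace k V]
      (hα : α ≠ 0) (I : Type u) (hI : ((#I : Cardinal.{u}) : WithTop Cardinal.{u}) < κ)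
      (W : I → Type u) [∀ i, NormedAddCommGroup (W i)] [∀ i, NormedSpace k (W i)]
      (β : I → Ordinal.{u}) (hβ : ∀ i, β i < α) (hW : ∀ i, ReidHierarchy k κ (β i) (W i))
      (e : V ≃ₗᵢ[k] BoundedProduct W) : ReidHierarchy k κ α V
  | sum (α : Ordinal.{u}) (V : Type u) [NormedAddCommGroup V] [NormedSpace k V]
      (hα : α ≠ 0) (I : Type u) (hI : ((#I : Cardinal.{u}) : WithTop Cardinal.{u}) < κ)
      (W : I → Type u) [∀ i, NormedAddCommGroup (W i)] [∀ i, NormedSpace k (W i)]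
      (β : I → Ordinal.{u}) (hβ : ∀ i, β i < α) (hW : ∀ i, ReidHierarchy k κ (β i) (W i))
      (e : V ≃ₗᵢ[k] CompletedSum k W) : ReidHierarchy k κ α V

/-- The Reid class of Banach `k`-vector spaces with respect to `κ`: the union of all levels of
the Reid hierarchy. -/
def ReidClass (k : Type u) [NormedField k] (κ : WithTop Cardinal.{u})
    (V : Type u) [NormedAddCommGroup V] [NormedSpace k V] : Prop :=
  ∃ α : Ordinal.{u}, ReidHierarchy k κ α V

/-! Write `E` for the space of bounded continuous functions on `ℚ`. Operators `ι : Eᵛ → V` and `Q :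
E → Vᵛ` (where `ᵛ` is the dual) define a form `B f μ = Q f (ι μ)`. If `V` lies in the Reid class,
every such form is `Negligible`: inside any nonempty clopen set there is a smaller one such that `B`
is as small as desired on functions and functionals of norm at most one supported there. For `V =
Eᵛ` the form `μ f` arises from the identity and the inclusion into the double dual. It takes the
value 1 on the indicator of a clopen set and the evaluation at one of its points, so it is not
negligible.

Negligibility is proved by induction on the Reid hierarchy. Its source is that, over a field that is
not spherically complete, functionals on `ℓ^∞(I)` are given by null families when `I` is not
`ω₁`-measurable (`hasSum_apply_singleton`, `eq_zero_of_vanish_on_singletons`). For `k ^ n` the form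
is a finite sum of rank one forms, settled by summing functions along clopen sets that decrease to
the empty set. For a product or a sum, `B` is the sum of the forms `B i` passing through the
factors. In a product, `B i f` tends to zero for fixed `f`, uniformly in `μ`; in a completed sum, `B
i f μ` tends to zero for fixed `μ`, uniformly in `f`. In either case a gliding hump
(`false_of_diagonal_large`) makes all but finitely many `B i` uniformly small on one clopen set, and
the induction hypothesis treats the rest. -/

open Filter Topology

/-! ### Bounded functionals on `ℓ^∞(I)` over a field that is not spherically complete. -/

section BoundedFamilies

variable {k : Type*} [NontriviallyNormedField k] {I J : Type*}

variable (k) in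
/-- The operator from bounded scalar families on `J` to bounded families on `I` that pulls back
along `g : I → J` and then multiplies by the bounded family `w`. -/
noncomputable def lpPullbackSMul {W : I → Type*} [∀ i, NormedAddCommGroup (W i)]
    [∀ i, NormedSpace k (W i)] (g : I → J) (w : lp W ∞) :
    lp (fun _ : J => k) ∞ →L[k] lp W ∞ :=
  have key (a : lp (fun _ : J => k) ∞) (i : I) : ‖a (g i) • w i‖ ≤ ‖w‖ * ‖a‖ := by
    rw [norm_smul, mul_comm]
    exact mul_le_mul (lp.norm_apply_le_norm ENNReal.top_ne_zero w i)
      (lp.norm_apply_le_norm ENNReal.top_ne_zero a _) (norm_nonneg _) (norm_nonneg _)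
  LinearMap.mkContinuous
    { toFun := fun a => ⟨fun i => a (g i) • w i, memℓp_infty ⟨‖w‖ * ‖a‖, by
        rintro _ ⟨i, rfl⟩
        exact key a i⟩⟩
      map_add' := fun a b => by
        ext i
        exact add_smul (a (g i)) (b (g i)) (w i)
      map_smul' := fun c a => by
        ext i
        exact smul_assoc c (a (g i)) (w i) } ‖w‖
    fun a => lp.norm_le_of_forall_le (by positivity) (key a)

@[simp]
theorem lpPullbackSMul_apply {W : I → Type*} [∀ i, NormedAddCommGroup (W i)]
    [∀ i, NormedSpace k (W i)] (g : I → J) (w : lp W ∞) (a : lp (fun _ : J => k) ∞) (i : I) :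
    lpPullbackSMul k g w a i = a (g i) • w i := rfl

variable (k) in
/-- The indicator function of a set as a bounded scalar family. -/
noncomputable def lpIndicator (A : Set I) : lp (fun _ : I => k) ∞ :=
  ⟨A.indicator 1, memℓp_infty ⟨1, by
    rintro _ ⟨i, rfl⟩
    by_cases h : i ∈ A <;> simp [h]⟩⟩

theorem lpIndicator_apply (A : Set I) (i : I) :
    lpIndicator k A i = A.indicator (1 : I → k) i := rfl

@[simp]
theorem lpIndicator_of_mem {A : Set I} {i : I} (h : i ∈ A) : lpIndicator k A i = 1 := by
  simp [lpIndicator_apply, h]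

@[simp]
theorem lpIndicator_of_notMem {A : Set I} {i : I} (h : i ∉ A) : lpIndicator k A i = 0 := by
  simp [lpIndicator_apply, h]

theorem norm_lpIndicator_le (A : Set I) : ‖lpIndicator k A‖ ≤ 1 :=
  lp.norm_le_of_forall_le zero_le_one fun i => by by_cases h : i ∈ A <;> simp [h]

theorem lpIndicator_empty : lpIndicator k (∅ : Set I) = 0 := by
  ext i
  simp

theorem lpIndicator_union {A B : Set I} (h : Disjoint A B) :
    lpIndicator k (A ∪ B) = lpIndicator k A + lpIndicator k B := by
  ext i
  exact congrFun (Set.indicator_union_of_disjoint h (1 : I → k)) i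

theorem lpPullbackSMul_lpIndicator_lpIndicator (g : I → J) (A : Set I) (B : Set J) :
    lpPullbackSMul k g (lpIndicator k A) (lpIndicator k B) = lpIndicator k (A ∩ g ⁻¹' B) := by
  ext i
  by_cases hA : i ∈ A <;> by_cases hB : g i ∈ B <;> simp [hA, hB]

theorem lpPullbackSMul_id_lpIndicator_singleton (w : lp (fun _ : I => k) ∞) (i : I) :
    lpPullbackSMul k id w (lpIndicator k {i}) = w i • lpIndicator k {i} := by
  ext j
  by_cases h : j = i
  · subst h; simp
  · simp [h]

theorem lpPullbackSMul_id_lpIndicator_univ (w : lp (fun _ : I => k) ∞) :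
    lpPullbackSMul k id w (lpIndicator k Set.univ) = w := by
  ext j
  simp

theorem hasSum_lpIndicator_singleton_mul (i : I) (x : I → k) :
    HasSum (fun j => lpIndicator k {i} j * x j) (x i) := by
  have h := hasSum_single (f := fun j => lpIndicator k {i} j * x j) i fun j hj => by simp [hj]
  simpa using h

/-- Changing finitely many coordinates does not affect `φ`, so those in `s` may be set to zero. -/
theorem norm_apply_le_of_vanish_on_singletons (φ : StrongDual k (lp (fun _ : I => k) ∞))
    (hφ : ∀ i, φ (lpIndicator k {i}) = 0) {C : ℝ} (hC : 0 ≤ C) (s : Finset I)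
    (a : lp (fun _ : I => k) ∞) (ha : ∀ i ∉ s, ‖a i‖ ≤ C) : ‖φ a‖ ≤ ‖φ‖ * C := by
  classical
  have hval (i : I) : (a - ∑ j ∈ s, a j • lpIndicator k {j}) i = if i ∈ s then 0 else a i := by
    have h1 : (∑ j ∈ s, a j • lpIndicator k {j}) i = ∑ j ∈ s, a j * lpIndicator k {j} i := by
      rw [lp.coeFn_sum, Finset.sum_apply]
      rfl
    have h2 (j : I) : a j * lpIndicator k {j} i = if i = j then a j else 0 := by
      by_cases h : i = j <;> simp [h]
    rw [lp.coeFn_sub, Pi.sub_apply, h1]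
    simp only [h2, Finset.sum_ite_eq]
    split_ifs <;> simp
  have hb : ‖a - ∑ j ∈ s, a j • lpIndicator k {j}‖ ≤ C := by
    refine lp.norm_le_of_forall_le hC fun i => ?_
    rw [hval]
    split_ifs with h
    · simpa using hC
    · exact ha i h
  have h0 : φ a = φ (a - ∑ j ∈ s, a j • lpIndicator k {j}) := by
    simp [map_sub, map_sum, hφ]
  rw [h0]
  exact φ.le_of_opNorm_le_of_le le_rfl hb

/-- If no such vector existed, rescaling would make `‖φ‖ / (1 + δ)` an operator bound for `φ`. -/
theorem exists_apply_eq_one_of_ne_zero {F : Type*} [SeminormedAddCommGroup F] [NormedSpace k F]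
    (φ : StrongDual k F) (hφ : φ ≠ 0) {δ : ℝ} (hδ : 0 < δ) :
    ∃ x, φ x = 1 ∧ ‖φ‖ * ‖x‖ ≤ 1 + δ := by
  by_contra! hcon
  have hpos : 0 < ‖φ‖ := (norm_nonneg φ).lt_of_ne' fun h => hφ (by
    ext x
    simpa [h] using φ.le_opNorm x)
  have : ‖φ‖ ≤ ‖φ‖ / (1 + δ) := by
    refine φ.opNorm_le_bound (by positivity) fun x => ?_
    by_cases hx : φ x = 0
    · rw [hx, norm_zero]; positivity
    · have h := hcon ((φ x)⁻¹ • x) (by simp [hx])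
      rw [norm_smul, norm_inv] at h
      have hx' : 0 < ‖φ x‖ := norm_pos_iff.mpr hx
      rw [div_mul_eq_mul_div, le_div_iff₀ (by positivity)]
      have : (1 + δ) * ‖φ x‖ ≤ ‖φ‖ * (‖φ x‖⁻¹ * ‖x‖) * ‖φ x‖ :=
        mul_le_mul_of_nonneg_right h.le hx'.le
      calc ‖φ x‖ * (1 + δ) ≤ ‖φ‖ * (‖φ x‖⁻¹ * ‖x‖) * ‖φ x‖ := by linarith
        _ = ‖φ‖ * ‖x‖ := by field_simp
  rw [le_div_iff₀ (by positivity)] at this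
  nlinarith

theorem exists_closedBall_iInter_empty (hsph : ¬ SphericallyComplete k) :
    ∃ (c : ℕ → k) (r : ℕ → ℝ), (∀ n, 0 < r n) ∧ (∀ n m, n ≤ m → ‖c m - c n‖ ≤ r n) ∧
      ∀ x, ∃ n, r n < ‖x - c n‖ := by
  unfold SphericallyComplete at hsph
  push Not at hsph
  obtain ⟨c, r, hr, hanti, hempty⟩ := hsph
  refine ⟨c, r, hr, fun n m hnm => ?_, fun x => ?_⟩
  · have := hanti hnm (Metric.mem_closedBall_self (hr m).le)
    rwa [Metric.mem_closedBall, dist_eq_norm] at this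
  · by_contra! h
    have : x ∈ ⋂ n, Metric.closedBall (c n) (r n) := by
      simpa [Metric.mem_closedBall, dist_eq_norm] using h
    rw [hempty] at this
    exact this

variable [IsUltrametricDist k]

/-- Over a field that is not spherically complete, a bounded functional on `ℓ^∞(ℕ)` that kills
all finite sequences is zero. -/
theorem eq_zero_of_vanish_on_singletons_nat (hsph : ¬ SphericallyComplete k)
    (φ : StrongDual k (lp (fun _ : ℕ => k) ∞)) (hφ : ∀ i, φ (lpIndicator k {i}) = 0) : φ = 0 := by
  by_contra h0
  obtain ⟨c, r, hr, hc, hout⟩ := exists_closedBall_iInter_empty hsph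
  choose x hx1 hx using fun n : ℕ =>
    exists_apply_eq_one_of_ne_zero φ h0 (Nat.one_div_pos_of_nat (α := ℝ) (n := n))
  have hpos : 0 < ‖φ‖ := norm_pos_iff.mpr h0
  have hd (n m : ℕ) (hnm : n ≤ m) : ‖c (m + 1) - c m‖ ≤ r n := by
    have : c (m + 1) - c m = (c (m + 1) - c n) + (c n - c m) := by ring
    rw [this]
    exact (IsUltrametricDist.norm_add_le_max _ _).trans
      (max_le (hc n _ (by omega)) (norm_sub_rev (c m) (c n) ▸ hc n m hnm))
  have hterm (n m l j : ℕ) (hnl : n ≤ l) (hml : m ≤ l) :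
      ‖(c (l + 1) - c l) * x l j‖ ≤ r n * ((1 + 1 / ((m : ℝ) + 1)) / ‖φ‖) := by
    rw [norm_mul]
    refine mul_le_mul (hd n l hnl) ?_ (norm_nonneg _) (hr n).le
    refine (lp.norm_apply_le_norm ENNReal.top_ne_zero (x l) j).trans ?_
    rw [le_div_iff₀ hpos, mul_comm]
    refine (hx l).trans ?_
    gcongr
  -- `z` stands for the sum of all `(c (l + 1) - c l) • x l`, which need not converge in norm.
  -- Keeping only the terms `l ≤ j` in coordinate `j` changes each term in finitely many
  -- coordinates, which `φ` does not see. Hence `φ z + c 0` behaves like a limit of the centres.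
  let z : lp (fun _ : ℕ => k) ∞ :=
    ⟨fun j => ∑ l ∈ Finset.range (j + 1), (c (l + 1) - c l) * x l j,
      memℓp_infty ⟨r 0 * ((1 + 1 / (((0 : ℕ) : ℝ) + 1)) / ‖φ‖), by
        rintro _ ⟨j, rfl⟩
        exact IsUltrametricDist.norm_sum_le_of_forall_le_of_nonneg
          (mul_nonneg (hr 0).le (by positivity)) fun l _ =>
            hterm 0 0 l j (Nat.zero_le _) (Nat.zero_le _)⟩⟩
  have hφsum (m : ℕ) : φ (∑ l ∈ Finset.range m, (c (l + 1) - c l) • x l) = c m - c 0 := by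
    simp only [map_sum, map_smul, hx1, smul_eq_mul, mul_one, Finset.sum_range_sub]
  have key (n m : ℕ) (hnm : n ≤ m) :
      ‖φ z + c 0 - c m‖ ≤ r n * (1 + 1 / ((m : ℝ) + 1)) := by
    have h1 : φ z + c 0 - c m =
        φ (z - ∑ l ∈ Finset.range m, (c (l + 1) - c l) • x l) := by
      rw [map_sub, hφsum]; ring
    rw [h1]
    refine (norm_apply_le_of_vanish_on_singletons φ hφ
      (C := r n * ((1 + 1 / ((m : ℝ) + 1)) / ‖φ‖))
      (mul_nonneg (hr n).le (by positivity)) (Finset.range m) _ fun j hj => ?_).trans_eq ?_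
    · have hj' : m ≤ j := by simpa using hj
      have h2 : (z - ∑ l ∈ Finset.range m, (c (l + 1) - c l) • x l) j =
          ∑ l ∈ Finset.Ico m (j + 1), (c (l + 1) - c l) * x l j := by
        rw [lp.coeFn_sub, Pi.sub_apply, lp.coeFn_sum, Finset.sum_apply,
          Finset.sum_Ico_eq_sub _ (by omega : m ≤ j + 1)]
        rfl
      rw [h2]
      refine IsUltrametricDist.norm_sum_le_of_forall_le_of_nonneg
        (mul_nonneg (hr n).le (by positivity)) fun l hl => ?_
      rw [Finset.mem_Ico] at hl
      exact hterm n m l j (hnm.trans hl.1) hl.1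
    · field_simp
  obtain ⟨n, hn⟩ := hout (φ z + c 0)
  -- Letting `m` tend to infinity removes the error factor and puts `φ z + c 0` into every ball.
  have hle (m : ℕ) (hnm : n ≤ m) :
      ‖φ z + c 0 - c n‖ ≤ r n * (1 + 1 / ((m : ℝ) + 1)) := by
    have : φ z + c 0 - c n = (φ z + c 0 - c m) + (c m - c n) := by ring
    rw [this]
    refine (IsUltrametricDist.norm_add_le_max _ _).trans (max_le (key n m hnm) ((hc n m hnm).trans ?_))
    have : (0 : ℝ) ≤ 1 / ((m : ℝ) + 1) := by positivity
    nlinarith [hr n]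
  have hlim : Tendsto (fun m : ℕ => r n * (1 + 1 / ((m : ℝ) + 1))) atTop (𝓝 (r n)) := by
    have := (tendsto_one_div_add_atTop_nhds_zero_nat (𝕜 := ℝ)).const_add 1
    simpa using this.const_mul (r n)
  exact absurd (ge_of_tendsto hlim (eventually_atTop.mpr ⟨n, hle⟩)) (not_le.mpr hn)

/-- Over a field that is not spherically complete, the values of a bounded functional on
`ℓ^∞(I)` at the unit vectors tend to zero. -/
theorem finite_le_norm_apply_singleton (hsph : ¬ SphericallyComplete k)
    (φ : StrongDual k (lp (fun _ : I => k) ∞)) {ε : ℝ} (hε : 0 < ε) :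
    {i | ε ≤ ‖φ (lpIndicator k {i})‖}.Finite := by
  classical
  by_contra hinf
  let σ := Set.Infinite.natEmbedding _ hinf
  have hσ : Function.Injective fun n => (σ n : I) :=
    Subtype.val_injective.comp σ.injective
  have hσε (n : ℕ) : ε ≤ ‖φ (lpIndicator k {(σ n : I)})‖ := (σ n).2
  let A : Set I := Set.range fun n => (σ n : I)
  -- The value of `g` off `A` is irrelevant, since the indicator of `A` multiplies the pullback.
  let g : I → ℕ := Function.extend (fun n => (σ n : I)) id 0
  have hg (n : ℕ) : g (σ n) = n := hσ.extend_apply _ _ n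
  let c : lp (fun _ : ℕ => k) ∞ := ⟨fun n => (φ (lpIndicator k {(σ n : I)}))⁻¹,
    memℓp_infty ⟨ε⁻¹, by
      rintro _ ⟨n, rfl⟩
      change ‖(φ (lpIndicator k {(σ n : I)}))⁻¹‖ ≤ ε⁻¹
      rw [norm_inv]
      exact inv_anti₀ hε (hσε n)⟩⟩
  -- The bounded rescaling by `c` makes `ψ` equal to 1 on every unit vector.
  let ψ : StrongDual k (lp (fun _ : ℕ => k) ∞) :=
    (φ.comp (lpPullbackSMul k g (lpIndicator k A))).comp (lpPullbackSMul k id c)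
  have hψ (n : ℕ) : ψ (lpIndicator k {n}) = 1 := by
    have hA : A ∩ g ⁻¹' {n} = {(σ n : I)} := by
      ext i
      constructor
      · rintro ⟨⟨m, rfl⟩, hm⟩
        have : m = n := (hg m).symm.trans hm
        subst this
        rfl
      · rintro rfl
        exact ⟨⟨n, rfl⟩, hg n⟩
    change φ (lpPullbackSMul k g (lpIndicator k A) (lpPullbackSMul k id c (lpIndicator k {n}))) = 1
    rw [lpPullbackSMul_id_lpIndicator_singleton, map_smul, map_smul,
      lpPullbackSMul_lpIndicator_lpIndicator, hA, smul_eq_mul]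
    refine inv_mul_cancel₀ fun h => ?_
    have := hσε n
    rw [h, norm_zero] at this
    linarith
  -- The shift annihilates the first unit vector and permutes the others.
  let S : lp (fun _ : ℕ => k) ∞ →L[k] lp (fun _ : ℕ => k) ∞ :=
    lpPullbackSMul k Nat.succ (lpIndicator k Set.univ)
  have hS (B : Set ℕ) : S (lpIndicator k B) = lpIndicator k (Nat.succ ⁻¹' B) := by
    simpa using lpPullbackSMul_lpIndicator_lpIndicator (k := k) Nat.succ Set.univ B
  let e : StrongDual k (lp (fun _ : ℕ => k) ∞) :=
    (ψ.comp (lpPullbackSMul k id (lpIndicator k {0})))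
  have hzero : ψ - ψ.comp S - e = 0 := by
    refine eq_zero_of_vanish_on_singletons_nat hsph _ fun n => ?_
    change ψ (lpIndicator k {n}) - ψ (S (lpIndicator k {n})) -
      ψ (lpPullbackSMul k id (lpIndicator k {0}) (lpIndicator k {n})) = 0
    rw [hS, lpPullbackSMul_id_lpIndicator_singleton, map_smul, hψ]
    cases n with
    | zero =>
      have : Nat.succ ⁻¹' {0} = (∅ : Set ℕ) := by ext; simp
      rw [this, lpIndicator_empty]
      simp
    | succ n =>
      have : Nat.succ ⁻¹' {n + 1} = ({n} : Set ℕ) := by ext; simp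
      rw [this, hψ]
      simp
  -- The shift fixes the constant family 1, so there the difference is `-ψ (lpIndicator k {0}) =
  -- -1`.
  have h1 : ψ (lpIndicator k Set.univ) - ψ (S (lpIndicator k Set.univ)) -
      ψ (lpPullbackSMul k id (lpIndicator k {0}) (lpIndicator k Set.univ)) = 0 :=
    DFunLike.congr_fun hzero (lpIndicator k Set.univ)
  rw [hS, lpPullbackSMul_id_lpIndicator_univ, hψ, Set.preimage_univ] at h1
  simp at h1

variable [CompleteSpace k]

/-- A bounded family of functionals that tends to zero pointwise can be summed with bounded
coefficients. -/
theorem exists_hasSum_strongDual {F : Type*} [SeminormedAddCommGroup F] [NormedSpace k F]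
    (ν : I → StrongDual k F) (C : ℝ) (hC : 0 ≤ C) (hν : ∀ i x, ‖ν i x‖ ≤ C * ‖x‖)
    (h : ∀ x, Tendsto (fun i => ν i x) cofinite (𝓝 0)) :
    ∃ Λ : lp (fun _ : I => k) ∞ →L[k] StrongDual k F,
      ∀ a x, HasSum (fun i => a i * ν i x) (Λ a x) := by
  have hs (a : lp (fun _ : I => k) ∞) (x : F) : Summable fun i => a i * ν i x := by
    refine NonarchimedeanAddGroup.summable_of_tendsto_cofinite_zero ?_
    refine squeeze_zero_norm (a := fun i => ‖a‖ * ‖ν i x‖) (fun i => ?_) ?_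
    · rw [norm_mul]
      gcongr
      exact lp.norm_apply_le_norm ENNReal.top_ne_zero a i
    · simpa using (h x).norm.const_mul ‖a‖
  refine ⟨LinearMap.mkContinuous₂ (LinearMap.mk₂ k (fun a x => ∑' i, a i * ν i x)
    ?_ ?_ ?_ ?_) C ?_, fun a x => (hs a x).hasSum⟩
  · intro a b x
    rw [← (hs a x).tsum_add (hs b x)]
    exact tsum_congr fun i => add_mul (a i) (b i) (ν i x)
  · intro c a x
    rw [smul_eq_mul, ← tsum_mul_left]
    exact tsum_congr fun i => mul_assoc c (a i) (ν i x)
  · intro a x y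
    rw [← (hs a x).tsum_add (hs a y)]
    exact tsum_congr fun i => by rw [map_add, mul_add]
  · intro c a x
    rw [smul_eq_mul, ← tsum_mul_left]
    exact tsum_congr fun i => by rw [map_smul, smul_eq_mul]; ring
  · intro a x
    refine IsUltrametricDist.norm_tsum_le_of_forall_le_of_nonneg (by positivity) fun i => ?_
    rw [norm_mul, mul_comm C, mul_assoc]
    exact mul_le_mul (lp.norm_apply_le_norm ENNReal.top_ne_zero a i) (hν i x)
      (norm_nonneg _) (norm_nonneg _)

/-- If finite families determine the bounded functionals on `ℓ^∞(I)`, then these functionals are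
given by summable families. -/
theorem hasSum_apply_singleton (hsph : ¬ SphericallyComplete k)
    (hI : ∀ φ : StrongDual k (lp (fun _ : I => k) ∞),
      (∀ i, φ (lpIndicator k {i}) = 0) → φ = 0)
    (φ : StrongDual k (lp (fun _ : I => k) ∞)) (a : lp (fun _ : I => k) ∞) :
    HasSum (fun i => a i * φ (lpIndicator k {i})) (φ a) := by
  classical
  -- With `F = k`, evaluating `Λ` at 1 gives the functional represented by the null family of values
  -- of `φ`.
  obtain ⟨Λ, hΛ⟩ := exists_hasSum_strongDual
    (fun i => φ (lpIndicator k {i}) • ContinuousLinearMap.id k k) ‖φ‖ (norm_nonneg _)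
    (fun i x => by
      change ‖φ (lpIndicator k {i}) * x‖ ≤ _
      rw [norm_mul]
      gcongr
      simpa using φ.le_of_opNorm_le_of_le le_rfl (norm_lpIndicator_le (k := k) {i}))
    (fun x => by
      have : Tendsto (fun i => φ (lpIndicator k {i})) cofinite (𝓝 0) := by
        rw [Metric.tendsto_nhds]
        intro ε hε
        simpa [Filter.eventually_cofinite] using finite_le_norm_apply_singleton hsph φ hε
      simpa using this.mul_const x)
  have hψ : φ - Λ.flip 1 = 0 := by
    refine hI _ fun i => ?_
    change φ (lpIndicator k {i}) - Λ (lpIndicator k {i}) 1 = 0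
    rw [(hΛ (lpIndicator k {i}) 1).unique (hasSum_lpIndicator_singleton_mul i _)]
    simp
  have h1 : φ a = Λ a 1 := by
    have : φ a - Λ a 1 = 0 := DFunLike.congr_fun hψ a
    exact sub_eq_zero.mp this
  rw [h1]
  simpa using hΛ a 1

end BoundedFamilies

/-! ### Functionals that kill the unit vectors, and countably complete ultrafilters. -/

section Measurability

variable {k : Type v} [NontriviallyNormedField k]

variable {I : Type u} (φ : StrongDual k (lp (fun _ : I => k) ∞)) (ε : ℝ)

/-- A set is `ε`-heavy for a functional on `ℓ^∞(I)` if it contains a set on whose indicator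
function the functional has norm at least `ε`. -/
def IsHeavy (A : Set I) : Prop := ∃ B ⊆ A, ε ≤ ‖φ (lpIndicator k B)‖

variable {φ ε}

theorem IsHeavy.mono {A B : Set I} (h : IsHeavy φ ε A) (hAB : A ⊆ B) : IsHeavy φ ε B := by
  obtain ⟨C, hC, hCε⟩ := h
  exact ⟨C, hC.trans hAB, hCε⟩

theorem not_isHeavy_of_subsingleton (hφ : ∀ i, φ (lpIndicator k {i}) = 0) (hε : 0 < ε)
    {A : Set I} (hA : A.Subsingleton) : ¬ IsHeavy φ ε A := by
  rintro ⟨B, hB, hBε⟩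
  rcases (hA.anti hB).eq_empty_or_singleton with rfl | ⟨i, rfl⟩
  · rw [lpIndicator_empty, map_zero, norm_zero] at hBε
    linarith
  · rw [hφ, norm_zero] at hBε
    linarith

variable [IsUltrametricDist k]

/-- Disjoint witnesses `B n` become the unit vectors of `ℓ^∞(ℕ)` after pulling back along the index
map `g`, and values on unit vectors tend to zero. -/
theorem not_forall_isHeavy_of_pairwise_disjoint (hsph : ¬ SphericallyComplete k) (hε : 0 < ε)
    (A : ℕ → Set I) (hA : Pairwise (Function.onFun Disjoint A)) : ¬ ∀ n, IsHeavy φ ε (A n) := by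
  classical
  intro h
  choose B hBA hB using h
  choose! g hg using fun i (hi : i ∈ ⋃ n, B n) => Set.mem_iUnion.mp hi
  have hBg (n : ℕ) : (⋃ n, B n) ∩ g ⁻¹' {n} = B n := by
    ext i
    constructor
    · rintro ⟨hi, hin⟩
      have : g i = n := hin
      exact this ▸ hg i hi
    · intro hi
      have hi' : i ∈ ⋃ n, B n := Set.mem_iUnion.mpr ⟨n, hi⟩
      refine ⟨hi', ?_⟩
      by_contra hne
      exact Set.disjoint_left.mp (hA hne) (hBA _ (hg i hi')) (hBA n hi)
  have hfin := finite_le_norm_apply_singleton hsph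
    (φ.comp (lpPullbackSMul k g (lpIndicator k (⋃ n, B n)))) hε
  simp only [ContinuousLinearMap.comp_apply, lpPullbackSMul_lpIndicator_lpIndicator, hBg, hB]
    at hfin
  exact Set.infinite_univ (hfin.subset fun n _ => trivial)

/-- Otherwise heavy sets could be split forever, and the discarded halves would be infinitely many
disjoint heavy sets. -/
theorem exists_isHeavy_atom (hsph : ¬ SphericallyComplete k) (hε : 0 < ε)
    (h : IsHeavy φ ε Set.univ) :
    ∃ A, IsHeavy φ ε A ∧ ∀ C, ¬ (IsHeavy φ ε (A ∩ C) ∧ IsHeavy φ ε (A \ C)) := by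
  by_contra! hcon
  choose! c hc using hcon
  let A : ℕ → Set I := fun n => n.rec Set.univ fun _ X => X ∩ c X
  have hA (n : ℕ) : A (n + 1) = A n ∩ c (A n) := rfl
  have hheavy (n : ℕ) : IsHeavy φ ε (A n) := by
    induction n with
    | zero => exact h
    | succ n ih => exact (hc _ ih).1
  have hanti : Antitone A := antitone_nat_of_succ_le fun n => Set.inter_subset_left
  refine not_forall_isHeavy_of_pairwise_disjoint hsph hε (fun n => A n \ c (A n)) ?_
    fun n => (hc _ (hheavy n)).2
  refine (pairwise_disjoint_on _).mpr fun m n hmn => ?_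
  refine Set.disjoint_left.mpr fun i him hin => him.2 ?_
  exact (hanti (Nat.succ_le_of_lt hmn) hin.1).2

variable [CompleteSpace k]

theorem hasSum_apply_singleton_nat (hsph : ¬ SphericallyComplete k)
    (φ : StrongDual k (lp (fun _ : ℕ => k) ∞)) (a : lp (fun _ : ℕ => k) ∞) :
    HasSum (fun n => a n * φ (lpIndicator k {n})) (φ a) :=
  hasSum_apply_singleton hsph (eq_zero_of_vanish_on_singletons_nat hsph) φ a

theorem norm_le_of_forall_singleton_nat (hsph : ¬ SphericallyComplete k)
    (φ : StrongDual k (lp (fun _ : ℕ => k) ∞)) (a : lp (fun _ : ℕ => k) ∞) {C : ℝ} (hC : 0 ≤ C)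
    (h : ∀ n, ‖a n * φ (lpIndicator k {n})‖ ≤ C) : ‖φ a‖ ≤ C := by
  rw [← (hasSum_apply_singleton_nat hsph φ a).tsum_eq]
  exact IsUltrametricDist.norm_tsum_le_of_forall_le_of_nonneg hC h

/-- On a countable partition `φ` is countably additive, and by the ultrametric inequality one piece
carries the full norm `ε`. As `ε` does not deteriorate, the sets that are not heavy form a
`σ`-ideal. -/
theorem exists_isHeavy_of_iUnion (hsph : ¬ SphericallyComplete k) (hε : 0 < ε) (A : ℕ → Set I)
    (h : IsHeavy φ ε (⋃ n, A n)) : ∃ n, IsHeavy φ ε (A n) := by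
  classical
  obtain ⟨B, hB, hBε⟩ := h
  choose! g hg using fun i (hi : i ∈ B) => Set.mem_iUnion.mp (hB hi)
  have hsum := hasSum_apply_singleton_nat hsph (φ.comp (lpPullbackSMul k g (lpIndicator k B)))
    (lpIndicator k Set.univ)
  simp only [ContinuousLinearMap.comp_apply, lpPullbackSMul_lpIndicator_lpIndicator,
    Set.preimage_univ, Set.inter_univ, lpIndicator_of_mem (Set.mem_univ _), one_mul] at hsum
  obtain ⟨s, hs⟩ := ((Metric.tendsto_nhds.mp hsum) ε hε).exists
  rw [dist_eq_norm] at hs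
  have hge : ε ≤ ‖∑ n ∈ s, φ (lpIndicator k (B ∩ g ⁻¹' {n}))‖ := by
    by_contra! hlt
    have := IsUltrametricDist.norm_add_le_max
      (φ (lpIndicator k B) - ∑ n ∈ s, φ (lpIndicator k (B ∩ g ⁻¹' {n})))
      (∑ n ∈ s, φ (lpIndicator k (B ∩ g ⁻¹' {n})))
    rw [sub_add_cancel, norm_sub_rev] at this
    exact absurd (hBε.trans this) (not_le.mpr (max_lt hs hlt))
  obtain ⟨n, -, hn⟩ := IsUltrametricDist.exists_norm_finsetSum_le s
    fun n => φ (lpIndicator k (B ∩ g ⁻¹' {n}))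
  refine ⟨n, B ∩ g ⁻¹' {n}, ?_, hge.trans hn⟩
  rintro i ⟨hi, hin⟩
  have : g i = n := hin
  exact this ▸ hg i hi

theorem isHeavy_union (hsph : ¬ SphericallyComplete k) (hε : 0 < ε) {A B : Set I}
    (h : IsHeavy φ ε (A ∪ B)) : IsHeavy φ ε A ∨ IsHeavy φ ε B := by
  obtain ⟨n, hn⟩ := exists_isHeavy_of_iUnion hsph hε (fun n : ℕ => if n = 0 then A else B)
    (h.mono (Set.union_subset
      (Set.subset_iUnion_of_subset 0 (by simp)) (Set.subset_iUnion_of_subset 1 (by simp))))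
  by_cases h0 : n = 0
  · exact Or.inl (by simpa [h0] using hn)
  · exact Or.inr (by simpa [h0] using hn)

/-- On an index set that is not `ω₁`-measurable, bounded functionals on `ℓ^∞(I)` are determined
by their values on the unit vectors. -/
theorem eq_zero_of_vanish_on_singletons (hsph : ¬ SphericallyComplete k)
    (hI : ¬ CardinalMeasurable ℵ₁ I) (φ : StrongDual k (lp (fun _ : I => k) ∞))
    (hφ : ∀ i, φ (lpIndicator k {i}) = 0) : φ = 0 := by
  -- Multiplication by `a` reduces the value at `a` to a value at the constant family 1.
  suffices key : ∀ ψ : StrongDual k (lp (fun _ : I => k) ∞),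
      (∀ i, ψ (lpIndicator k {i}) = 0) → ψ (lpIndicator k Set.univ) = 0 by
    ext a
    have := key (φ.comp (lpPullbackSMul k id a)) fun i => by
      rw [ContinuousLinearMap.comp_apply, lpPullbackSMul_id_lpIndicator_singleton, map_smul, hφ,
        smul_zero]
    rwa [ContinuousLinearMap.comp_apply, lpPullbackSMul_id_lpIndicator_univ] at this
  intro ψ hψ
  by_contra h0
  set ε := ‖ψ (lpIndicator k Set.univ)‖ with hεdef
  have hε : 0 < ε := norm_pos_iff.mpr h0
  have huniv : IsHeavy ψ ε Set.univ := ⟨Set.univ, subset_rfl, le_rfl⟩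
  have hUnion (A : Set I) (S : Set (Set I)) (hS : S.Countable)
      (h : ∀ s ∈ S, ¬ IsHeavy ψ ε (A ∩ s)) : ¬ IsHeavy ψ ε (A ∩ ⋃₀ S) := by
    intro hh
    rcases S.eq_empty_or_nonempty with rfl | hne
    · exact not_isHeavy_of_subsingleton hψ hε Set.subsingleton_empty (by simpa using hh)
    · obtain ⟨f, rfl⟩ := hS.exists_eq_range hne
      rw [Set.sUnion_range, Set.inter_iUnion] at hh
      obtain ⟨n, hn⟩ := exists_isHeavy_of_iUnion hsph hε _ hh
      exact h _ ⟨n, rfl⟩ hn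
  refine hI ⟨?_, ?_⟩
  · rw [← not_countable_iff]
    intro hc
    refine hUnion Set.univ (Set.range fun i => {i}) (Set.countable_range _) ?_ ?_
    · rintro _ ⟨i, rfl⟩
      exact not_isHeavy_of_subsingleton hψ hε
        (Set.subsingleton_singleton.anti Set.inter_subset_right)
    · convert huniv using 1
      ext i
      simp
  · obtain ⟨A, hA, hatom⟩ := exists_isHeavy_atom hsph hε huniv
    -- Large sets are those whose complement in the atom `A` is not heavy. Of two complementary
    -- parts of `A` exactly one is heavy, so this is an ultrafilter.
    let F : Filter I := Filter.ofCountableUnion {s | ¬ IsHeavy ψ ε (A ∩ s)} (hUnion A)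
      fun t ht s hst hs => ht (hs.mono (Set.inter_subset_inter_right A hst))
    have hF (s : Set I) : s ∈ F ↔ ¬ IsHeavy ψ ε (A ∩ sᶜ) := Iff.rfl
    have hFc : CountableInterFilter F := Filter.countableInter_ofCountableUnion _ _ _
    refine ⟨Ultrafilter.ofComplNotMemIff F fun s => ?_,
      cardinalInterFilter_aleph_one_iff.mpr hFc, fun i hi => ?_⟩
    · rw [hF, hF, compl_compl, not_not, ← Set.sdiff_eq]
      refine ⟨fun h h' => hatom s ⟨h, h'⟩, fun h => ?_⟩
      rw [← Set.inter_union_sdiff A s] at hA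
      exact (isHeavy_union hsph hε hA).resolve_right h
    · have hmem : ({i} : Set I) ∈ F := by
        have : ({i} : Set I) ∈ (pure i : Ultrafilter I) := Set.mem_singleton i
        rw [← hi] at this
        exact this
      rw [hF, ← Set.sdiff_eq] at hmem
      rw [← Set.inter_union_sdiff A {i}] at hA
      rcases isHeavy_union hsph hε hA with h | h
      · exact not_isHeavy_of_subsingleton hψ hε
          (Set.subsingleton_singleton.anti Set.inter_subset_right) h
      · exact hmem h

end Measurability

/-! ### The gliding hump. -/

section Matrix

variable {k : Type v} [NontriviallyNormedField k] [IsUltrametricDist k] [CompleteSpace k]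

/-- A gliding hump argument: a sequence of bounded functionals on `ℓ^∞(ℕ)` that is pointwise
eventually small cannot have large diagonal values. -/
theorem false_of_diagonal_large (hsph : ¬ SphericallyComplete k)
    (θ : ℕ → StrongDual k (lp (fun _ : ℕ => k) ∞)) {ε : ℝ} (hε : 0 < ε)
    (hdiag : ∀ n, ε < ‖θ n (lpIndicator k {n})‖)
    (hfin : ∀ a, {n | ε / 2 < ‖θ n a‖}.Finite) : False := by
  classical
  -- Rows of the matrix `θ m (lpIndicator k {n})` are null, and columns are eventually at most `ε /
  -- 2`. Hence some subsequence has all off-diagonal entries at most `ε / 2`; the indicator of its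
  -- range then violates `hfin`.
  obtain ⟨σ, -, hσ⟩ := exists_seq_of_forall_finset_exists (fun _ : ℕ => True)
    (fun m n => m < n ∧ ‖θ m (lpIndicator k {n})‖ ≤ ε / 2 ∧ ‖θ n (lpIndicator k {m})‖ ≤ ε / 2) <| by
    intro s _
    have h1 : (⋃ m ∈ s, {n | ε / 2 ≤ ‖θ m (lpIndicator k {n})‖}).Finite :=
      s.finite_toSet.biUnion fun m _ => finite_le_norm_apply_singleton hsph (θ m) (half_pos hε)
    have h2 : (⋃ m ∈ s, {n | ε / 2 < ‖θ n (lpIndicator k {m})‖}).Finite :=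
      s.finite_toSet.biUnion fun m _ => hfin _
    have h3 : (⋃ m ∈ s, {n | n ≤ m}).Finite :=
      s.finite_toSet.biUnion fun m _ => Set.finite_le_nat m
    obtain ⟨n, hn⟩ := ((h1.union h2).union h3).exists_notMem
    refine ⟨n, trivial, fun m hm => ?_⟩
    simp only [Set.mem_union, Set.mem_iUnion, Set.mem_ofPred_eq, not_or, not_exists, not_le,
      not_lt] at hn
    exact ⟨hn.2 m hm, (hn.1.1 m hm).le, hn.1.2 m hm⟩
  have hmono : StrictMono σ := strictMono_nat_of_lt_succ fun n => (hσ n (n + 1) n.lt_succ_self).1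
  refine (Set.infinite_range_of_injective hmono.injective)
    ((hfin (lpIndicator k (Set.range σ))).subset ?_)
  rintro _ ⟨l, rfl⟩
  have hrest : ‖θ (σ l) (lpIndicator k (Set.range σ \ {σ l}))‖ ≤ ε / 2 := by
    refine norm_le_of_forall_singleton_nat hsph _ _ (half_pos hε).le fun n => ?_
    by_cases hn : n ∈ Set.range σ \ {σ l}
    · rw [lpIndicator_of_mem hn, one_mul]
      obtain ⟨⟨m, rfl⟩, hml⟩ := hn
      have hml' : m ≠ l := fun h => hml (by rw [h]; rfl)
      rcases lt_or_gt_of_ne hml' with h | h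
      · exact (hσ m l h).2.2
      · exact (hσ l m h).2.1
    · rw [lpIndicator_of_notMem hn, zero_mul, norm_zero]
      exact (half_pos hε).le
  have hsplit : lpIndicator k (Set.range σ) =
      lpIndicator k {σ l} + lpIndicator k (Set.range σ \ {σ l}) := by
    rw [← lpIndicator_union Set.disjoint_sdiff_right,
      Set.union_sdiff_cancel (Set.singleton_subset_iff.mpr (Set.mem_range_self l))]
  change ε / 2 < ‖θ (σ l) (lpIndicator k (Set.range σ))‖
  rw [hsplit, map_add]
  have h1 := norm_sub_le_norm_add (θ (σ l) (lpIndicator k {σ l}))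
    (θ (σ l) (lpIndicator k (Set.range σ \ {σ l})))
  have h2 := hdiag (σ l)
  linarith

end Matrix

/-! ### Negligible forms and their localization. -/

section Negligible

variable {k : Type v} [NontriviallyNormedField k] {X : Type*} [TopologicalSpace X]

variable (k) in
/-- The bounded continuous functions of norm at most one that vanish outside of `V`. -/
def unitFunctionsOn (V : Set X) : Set (X →ᵇ k) :=
  {f | (∀ t, ‖f t‖ ≤ 1) ∧ ∀ t ∉ V, f t = 0}

variable (k) in
/-- The functionals of norm at most one on bounded continuous functions that depend only on the
restriction to `V`. -/
def unitFunctionalsOn (V : Set X) : Set (StrongDual k (X →ᵇ k)) :=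
  {μ | ∀ (h : X →ᵇ k) (C : ℝ), 0 ≤ C → (∀ t ∈ V, ‖h t‖ ≤ C) → ‖μ h‖ ≤ C}

theorem unitFunctionsOn_mono {V W : Set X} (h : V ⊆ W) :
    unitFunctionsOn k V ⊆ unitFunctionsOn k W :=
  fun _ hf => ⟨hf.1, fun t ht => hf.2 t fun hV => ht (h hV)⟩

theorem unitFunctionalsOn_mono {V W : Set X} (h : V ⊆ W) :
    unitFunctionalsOn k V ⊆ unitFunctionalsOn k W :=
  fun _ hμ f C hC hf => hμ f C hC fun t ht => hf t (h ht)

theorem norm_le_one_of_mem_unitFunctionsOn {V : Set X} {f : X →ᵇ k}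
    (hf : f ∈ unitFunctionsOn k V) : ‖f‖ ≤ 1 :=
  (BoundedContinuousFunction.norm_le zero_le_one).mpr hf.1

theorem norm_le_one_of_mem_unitFunctionalsOn {V : Set X} {μ : StrongDual k (X →ᵇ k)}
    (hμ : μ ∈ unitFunctionalsOn k V) : ‖μ‖ ≤ 1 :=
  μ.opNorm_le_bound zero_le_one fun h => by
    rw [one_mul]
    exact hμ h ‖h‖ (norm_nonneg h) fun t _ => h.norm_coe_le_norm t

/-- A form on functions and functionals is negligible if every nonempty clopen set contains a
smaller one on which the form is arbitrarily small. -/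
def Negligible (B : (X →ᵇ k) → StrongDual k (X →ᵇ k) → k) : Prop :=
  ∀ U : Set X, IsClopen U → U.Nonempty → ∀ ε : ℝ, 0 < ε → ∃ V ⊆ U, IsClopen V ∧ V.Nonempty ∧
    ∀ f ∈ unitFunctionsOn k V, ∀ μ ∈ unitFunctionalsOn k V, ‖B f μ‖ ≤ ε

theorem exists_small_of_finset {I : Type*} {B : I → (X →ᵇ k) → StrongDual k (X →ᵇ k) → k}
    (hB : ∀ i, Negligible (B i)) (F : Finset I) {U : Set X} (hU : IsClopen U) (hne : U.Nonempty)
    {ε : ℝ} (hε : 0 < ε) : ∃ V ⊆ U, IsClopen V ∧ V.Nonempty ∧ ∀ i ∈ F,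
      ∀ f ∈ unitFunctionsOn k V, ∀ μ ∈ unitFunctionalsOn k V, ‖B i f μ‖ ≤ ε := by
  classical
  induction F using Finset.induction_on with
  | empty => exact ⟨U, subset_rfl, hU, hne, by simp⟩
  | insert i F _ ih =>
    obtain ⟨V, hVU, hV, hVne, hVε⟩ := ih
    obtain ⟨W, hWV, hW, hWne, hWε⟩ := hB i V hV hVne ε hε
    refine ⟨W, hWV.trans hVU, hW, hWne, fun j hj f hf μ hμ => ?_⟩
    rcases Finset.mem_insert.mp hj with rfl | hj
    · exact hWε f hf μ hμ
    · exact hVε j hj f (unitFunctionsOn_mono hWV hf) μ (unitFunctionalsOn_mono hWV hμ)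

/-- The terms off `F` stay small when the clopen set shrinks, so the finitely many others can be
treated by further shrinking. -/
theorem negligible_of_hasSum [IsUltrametricDist k] {I : Type*}
    {B : (X →ᵇ k) → StrongDual k (X →ᵇ k) → k}
    {Bi : I → (X →ᵇ k) → StrongDual k (X →ᵇ k) → k}
    (hsum : ∀ f μ, HasSum (fun i => Bi i f μ) (B f μ)) (hBi : ∀ i, Negligible (Bi i))
    (hloc : ∀ U : Set X, IsClopen U → U.Nonempty → ∀ ε : ℝ, 0 < ε → ∃ V ⊆ U, IsClopen V ∧
      V.Nonempty ∧ ∃ F : Finset I, ∀ i ∉ F, ∀ f ∈ unitFunctionsOn k V,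
        ∀ μ ∈ unitFunctionalsOn k V, ‖Bi i f μ‖ ≤ ε) : Negligible B := by
  intro U hU hne ε hε
  obtain ⟨V, hVU, hV, hVne, F, hF⟩ := hloc U hU hne ε hε
  obtain ⟨W, hWV, hW, hWne, hWF⟩ := exists_small_of_finset hBi F hV hVne hε
  refine ⟨W, hWV.trans hVU, hW, hWne, fun f hf μ hμ => ?_⟩
  rw [← (hsum f μ).tsum_eq]
  refine IsUltrametricDist.norm_tsum_le_of_forall_le_of_nonneg hε.le fun i => ?_
  by_cases hi : i ∈ F
  · exact hWF i hi f hf μ hμ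
  · exact hF i hi f (unitFunctionsOn_mono hWV hf) μ (unitFunctionalsOn_mono hWV hμ)

theorem exists_injective_seq {I : Type*} (P : ℕ → I → Prop)
    (hP : ∀ m n i, m ≤ n → P n i → P m i) (h : ∀ n (F : Finset I), ∃ i ∉ F, P n i) :
    ∃ σ : ℕ → I, Function.Injective σ ∧ ∀ n, P n (σ n) := by
  classical
  obtain ⟨s, hs, hsr⟩ := exists_seq_of_forall_finset_exists (fun x : ℕ × I => P x.1 x.2)
    (fun x y => x.1 < y.1 ∧ x.2 ≠ y.2) <| by
    intro F _
    obtain ⟨i, hi, hPi⟩ := h (F.sup Prod.fst + 1) (F.image Prod.snd)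
    refine ⟨(F.sup Prod.fst + 1, i), hPi, fun x hx => ⟨?_, ?_⟩⟩
    · exact Nat.lt_succ_of_le (Finset.le_sup (f := Prod.fst) hx)
    · rintro rfl
      exact hi (Finset.mem_image_of_mem _ hx)
  have hmono : StrictMono fun n => (s n).1 :=
    strictMono_nat_of_lt_succ fun n => (hsr n (n + 1) n.lt_succ_self).1
  refine ⟨fun n => (s n).2, fun m n hmn => ?_, fun n => hP n _ _ (hmono.le_apply) (hs n)⟩
  by_contra hne
  rcases lt_or_gt_of_ne hne with hlt | hlt
  · exact (hsr m n hlt).2 hmn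
  · exact (hsr n m hlt).2 hmn.symm

variable [IsUltrametricDist k]

/-- Bounded continuous functions with supports in clopen sets that decrease to the empty set can
be summed with bounded coefficients. -/
theorem exists_hasSum_boundedContinuousFunction (C : ℕ → Set X) (hC : ∀ n, IsClosed (C n))
    (hanti : Antitone C) (hempty : ∀ t, ∃ n, t ∉ C n) (f : ℕ → X →ᵇ k)
    (hf : ∀ n, f n ∈ unitFunctionsOn k (C n)) :
    ∃ Λ : lp (fun _ : ℕ => k) ∞ →L[k] (X →ᵇ k), ∀ a t, HasSum (fun n => a n * f n t) (Λ a t) := by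
  -- On the open complement of `C n` only the terms below `n` survive: the sum is locally finite,
  -- hence continuous.
  have hzero (a : lp (fun _ : ℕ => k) ∞) {n : ℕ} {t : X} (ht : t ∉ C n) (m : ℕ)
      (hm : m ∉ Finset.range n) : a m * f m t = 0 := by
    rw [(hf m).2 t fun h => ht (hanti (by simpa using hm) h), mul_zero]
  have hs (a : lp (fun _ : ℕ => k) ∞) (t : X) : Summable fun n => a n * f n t := by
    obtain ⟨n, hn⟩ := hempty t
    exact summable_of_ne_finset_zero (s := Finset.range n) (hzero a hn)
  have hcont (a : lp (fun _ : ℕ => k) ∞) : Continuous fun t => ∑' n, a n * f n t := by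
    refine continuous_iff_continuousAt.mpr fun t => ?_
    obtain ⟨n, hn⟩ := hempty t
    have hc : Continuous fun t => ∑ m ∈ Finset.range n, a m * f m t := by fun_prop
    refine hc.continuousAt.congr ?_
    filter_upwards [(hC n).isOpen_compl.mem_nhds hn] with x hx
    exact (tsum_eq_sum (hzero a hx)).symm
  have hbound (a : lp (fun _ : ℕ => k) ∞) (t : X) : ‖∑' n, a n * f n t‖ ≤ ‖a‖ := by
    refine IsUltrametricDist.norm_tsum_le_of_forall_le_of_nonneg (norm_nonneg a) fun n => ?_
    rw [norm_mul, ← mul_one ‖a‖]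
    exact mul_le_mul (lp.norm_apply_le_norm ENNReal.top_ne_zero a n) ((hf n).1 t)
      (norm_nonneg _) (norm_nonneg _)
  refine ⟨LinearMap.mkContinuous
    { toFun := fun a => BoundedContinuousFunction.ofNormedAddCommGroup _ (hcont a) ‖a‖ (hbound a)
      map_add' := fun a b => ?_
      map_smul' := fun c a => ?_ } 1 fun a => ?_, fun a t => (hs a t).hasSum⟩
  · ext t
    change ∑' n, (a n + b n) * f n t = ∑' n, a n * f n t + ∑' n, b n * f n t
    rw [← (hs a t).tsum_add (hs b t)]
    exact tsum_congr fun i => add_mul _ _ _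
  · ext t
    change ∑' n, (c * a n) * f n t = c * ∑' n, a n * f n t
    rw [← tsum_mul_left]
    exact tsum_congr fun i => mul_assoc _ _ _
  · rw [one_mul]
    exact BoundedContinuousFunction.norm_ofNormedAddCommGroup_le _ (norm_nonneg a) (hbound a)

/-- Every nonempty clopen set contains a decreasing sequence of nonempty clopen subsets with empty
intersection. -/
def HasVanishingClopens (X : Type*) [TopologicalSpace X] : Prop :=
  ∀ U : Set X, IsClopen U → U.Nonempty → ∃ C : ℕ → Set X, Antitone C ∧
    (∀ n, IsClopen (C n) ∧ (C n).Nonempty ∧ C n ⊆ U) ∧ ∀ t, ∃ n, t ∉ C n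

/-- Every point of a clopen set has a countable neighbourhood basis of clopen subsets. -/
def HasClopenBases (X : Type*) [TopologicalSpace X] : Prop :=
  ∀ U : Set X, IsClopen U → ∀ q ∈ U, ∃ C : ℕ → Set X, Antitone C ∧
    (∀ n, IsClopen (C n) ∧ q ∈ C n ∧ C n ⊆ U) ∧ ∀ N ∈ 𝓝 q, ∃ n, C n ⊆ N

/-- Functions `f n` supported on vanishing clopen sets span a copy of the unit vectors of `ℓ^∞(ℕ)`
under `Λ`, so `g (f n)` tends to zero while `h` stays bounded. -/
theorem negligible_rank_one (hsph : ¬ SphericallyComplete k) (hX : HasVanishingClopens X)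
    (g : StrongDual k (X →ᵇ k)) (h : StrongDual k (StrongDual k (X →ᵇ k))) :
    Negligible fun f μ => g f * h μ := by
  intro U hU hne ε hε
  obtain ⟨C, hanti, hC, hempty⟩ := hX U hU hne
  by_contra! hcon
  choose f hf μ hμ hε' using fun n => hcon (C n) (hC n).2.2 (hC n).1 (hC n).2.1
  obtain ⟨Λ, hΛ⟩ := exists_hasSum_boundedContinuousFunction C (fun n => (hC n).1.isClosed) hanti
    hempty f hf
  have hΛn (n : ℕ) : Λ (lpIndicator k {n}) = f n := by
    ext t
    exact (hΛ _ t).unique (hasSum_lpIndicator_singleton_mul n fun n => f n t)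
  have hδ : 0 < ε / (‖h‖ + 1) := by positivity
  refine Set.infinite_univ ((finite_le_norm_apply_singleton hsph (g.comp Λ) hδ).subset
    fun n _ => ?_)
  change ε / (‖h‖ + 1) ≤ ‖g (Λ (lpIndicator k {n}))‖
  rw [hΛn, div_le_iff₀ (by positivity)]
  refine (hε' n).le.trans ?_
  rw [norm_mul]
  gcongr
  have := h.le_of_opNorm_le_of_le le_rfl (norm_le_one_of_mem_unitFunctionalsOn (hμ n))
  linarith

variable [CompleteSpace k]

/-- Localization for a family of forms that tends to zero for every fixed function. -/
theorem exists_small_off_finset_left (hsph : ¬ SphericallyComplete k) (hX : HasVanishingClopens X)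
    {I : Type*} (B : I → (X →ᵇ k) →L[k] StrongDual k (StrongDual k (X →ᵇ k)))
    (hB : ∀ f, ∀ δ : ℝ, 0 < δ → {i | ∃ μ, ‖μ‖ ≤ 1 ∧ δ < ‖B i f μ‖}.Finite)
    (U : Set X) (hU : IsClopen U) (hne : U.Nonempty) (ε : ℝ) (hε : 0 < ε) :
    ∃ V ⊆ U, IsClopen V ∧ V.Nonempty ∧ ∃ F : Finset I, ∀ i ∉ F, ∀ f ∈ unitFunctionsOn k V,
      ∀ μ ∈ unitFunctionalsOn k V, ‖B i f μ‖ ≤ ε := by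
  obtain ⟨C, hanti, hC, hempty⟩ := hX U hU hne
  by_contra! hcon
  obtain ⟨σ, hσ, hP⟩ := exists_injective_seq
    (fun n i => ∃ f ∈ unitFunctionsOn k (C n), ∃ μ ∈ unitFunctionalsOn k (C n), ε < ‖B i f μ‖)
    (fun m n i hmn ⟨f, hf, μ, hμ, h⟩ => ⟨f, unitFunctionsOn_mono (hanti hmn) hf, μ,
      unitFunctionalsOn_mono (hanti hmn) hμ, h⟩)
    (fun n F => hcon (C n) (hC n).2.2 (hC n).1 (hC n).2.1 F)
  choose f hf μ hμ hε' using hP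
  obtain ⟨Λ, hΛ⟩ := exists_hasSum_boundedContinuousFunction C (fun n => (hC n).1.isClosed) hanti
    hempty f hf
  have hΛn (n : ℕ) : Λ (lpIndicator k {n}) = f n := by
    ext t
    exact (hΛ _ t).unique (hasSum_lpIndicator_singleton_mul n fun n => f n t)
  -- All the `f n` are combined into the single function `Λ a`, to which the hypothesis on fixed
  -- functions applies.
  refine false_of_diagonal_large hsph (fun n => ((B (σ n)).flip (μ n)).comp Λ) hε
    (fun n => ?_) (fun a => ?_)
  · change ε < ‖B (σ n) (Λ (lpIndicator k {n})) (μ n)‖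
    rw [hΛn]
    exact hε' n
  · refine ((hB (Λ a) (ε / 2) (half_pos hε)).preimage hσ.injOn).subset fun n hn => ?_
    exact ⟨μ n, norm_le_one_of_mem_unitFunctionalsOn (hμ n), hn⟩

variable (k) in
/-- The point evaluation as a functional on bounded continuous functions. -/
noncomputable def pointEvaluation (q : X) : StrongDual k (X →ᵇ k) :=
  BoundedContinuousFunction.evalCLM k q

/-- Localization for a family of forms that tends to zero for every fixed functional. -/
theorem exists_small_off_finset_right (hsph : ¬ SphericallyComplete k) (hX : HasClopenBases X)
    {I : Type*} (B : I → (X →ᵇ k) →L[k] StrongDual k (StrongDual k (X →ᵇ k)))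
    (hB : ∀ μ, ∀ δ : ℝ, 0 < δ → {i | ∃ f, ‖f‖ ≤ 1 ∧ δ < ‖B i f μ‖}.Finite)
    (U : Set X) (hU : IsClopen U) (hne : U.Nonempty) (ε : ℝ) (hε : 0 < ε) :
    ∃ V ⊆ U, IsClopen V ∧ V.Nonempty ∧ ∃ F : Finset I, ∀ i ∉ F, ∀ f ∈ unitFunctionsOn k V,
      ∀ μ ∈ unitFunctionalsOn k V, ‖B i f μ‖ ≤ ε := by
  classical
  obtain ⟨q, hq⟩ := hne
  obtain ⟨C, hanti, hC, hbasis⟩ := hX U hU q hq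
  by_contra! hcon
  have hF0 := hB (pointEvaluation k q) (ε / 2) (half_pos hε)
  obtain ⟨σ, hσ, hP⟩ := exists_injective_seq
    (fun n i => (∀ f, ‖f‖ ≤ 1 → ‖B i f (pointEvaluation k q)‖ ≤ ε / 2) ∧
      ∃ f ∈ unitFunctionsOn k (C n), ∃ μ ∈ unitFunctionalsOn k (C n), ε < ‖B i f μ‖)
    (fun m n i hmn ⟨h0, f, hf, μ, hμ, h⟩ => ⟨h0, f, unitFunctionsOn_mono (hanti hmn) hf, μ,
      unitFunctionalsOn_mono (hanti hmn) hμ, h⟩)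
    (fun n F => by
      obtain ⟨i, hi, h⟩ := hcon (C n) (hC n).2.2 (hC n).1 ⟨q, (hC n).2.1⟩ (F ∪ hF0.toFinset)
      rw [Finset.mem_union, not_or] at hi
      refine ⟨i, hi.1, fun f hf => ?_, h⟩
      by_contra! hlt
      exact hi.2 (hF0.mem_toFinset.mpr ⟨f, hf, hlt⟩))
  choose h0 f hf μ hμ hε' using hP
  -- The `μ n` concentrate at `q` but need not tend to zero pointwise. Subtracting their mass at `q`
  -- gives `ν n h = μ n (h - h q)`, which tends to zero by continuity of `h`. The correction costs
  -- at most `ε / 2`, since the indices with a large form at the evaluation in `q` were excluded.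
  let ν : ℕ → StrongDual k (X →ᵇ k) := fun n =>
    μ n - μ n (BoundedContinuousFunction.const X 1) • pointEvaluation k q
  have hν (n : ℕ) (h : X →ᵇ k) : ν n h = μ n (h - BoundedContinuousFunction.const X (h q)) := by
    have : BoundedContinuousFunction.const X (h q) =
        h q • BoundedContinuousFunction.const X (1 : k) := by
      ext t
      simp
    rw [this, map_sub, map_smul, smul_eq_mul, mul_comm]
    rfl
  have hμ1 (n : ℕ) : ‖μ n (BoundedContinuousFunction.const X 1)‖ ≤ 1 :=
    hμ n _ 1 zero_le_one fun t _ => by simp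
  obtain ⟨Λ, hΛ⟩ := exists_hasSum_strongDual ν 2 zero_le_two
    (fun n h => by
      rw [hν]
      refine hμ n _ _ (by positivity) fun t _ => ?_
      refine (norm_sub_le (h t) (h q)).trans ?_
      have h1 := h.norm_coe_le_norm t
      have h2 := h.norm_coe_le_norm q
      linarith)
    (fun h => by
      rw [Nat.cofinite_eq_atTop, Metric.tendsto_atTop]
      intro δ hδ
      obtain ⟨N, hN⟩ := hbasis _ (h.continuous.continuousAt (Metric.ball_mem_nhds (h q)
        (half_pos hδ)))
      refine ⟨N, fun n hn => ?_⟩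
      rw [dist_zero_right, hν]
      refine (hμ n _ _ (half_pos hδ).le fun t ht => ?_).trans_lt (half_lt_self hδ)
      have := hN (hanti hn ht)
      rw [Set.mem_preimage, Metric.mem_ball, dist_eq_norm] at this
      exact this.le)
  have hΛn (n : ℕ) : Λ (lpIndicator k {n}) = ν n := by
    ext h
    exact (hΛ _ h).unique (hasSum_lpIndicator_singleton_mul n fun n => ν n h)
  refine false_of_diagonal_large hsph (fun n => (B (σ n) (f n)).comp Λ) (half_pos hε)
    (fun n => ?_) (fun a => ?_)
  · change ε / 2 < ‖B (σ n) (f n) (Λ (lpIndicator k {n}))‖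
    rw [hΛn, map_sub, map_smul]
    have h1 := hε' n
    have h2 := norm_sub_norm_le (B (σ n) (f n) (μ n))
      (μ n (BoundedContinuousFunction.const X 1) • B (σ n) (f n) (pointEvaluation k q))
    have h3 : ‖μ n (BoundedContinuousFunction.const X 1) •
        B (σ n) (f n) (pointEvaluation k q)‖ ≤ 1 * (ε / 2) := by
      rw [norm_smul]
      exact mul_le_mul (hμ1 n) (h0 n _ (norm_le_one_of_mem_unitFunctionsOn (hf n)))
        (norm_nonneg _) zero_le_one
    linarith
  · refine ((hB (Λ a) (ε / 2 / 2) (half_pos (half_pos hε))).preimage hσ.injOn).subset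
      fun n hn => ?_
    exact ⟨f n, norm_le_one_of_mem_unitFunctionsOn (hf n), hn⟩

end Negligible

/-! ### Forms that factor through products and completed sums. -/

section Factorization

variable {k : Type v} [NontriviallyNormedField k] {X : Type*} [TopologicalSpace X]

/-- Precomposition of a family of functionals with an operator. -/
noncomputable def dualPrecomp {E V V' : Type*} [SeminormedAddCommGroup E] [NormedSpace k E]
    [SeminormedAddCommGroup V] [NormedSpace k V] [SeminormedAddCommGroup V'] [NormedSpace k V']
    (Q : E →L[k] StrongDual k V) (T : V' →L[k] V) : E →L[k] StrongDual k V' :=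
  ((ContinuousLinearMap.compL k V' V k).flip T).comp Q

theorem exists_pos_bound_of_norm_le_one {E V : Type*} [SeminormedAddCommGroup E]
    [NormedSpace k E] [SeminormedAddCommGroup V] [NormedSpace k V]
    (Q : E →L[k] StrongDual k V) :
    ∃ C : ℝ, 0 < C ∧ ∀ x y, ‖x‖ ≤ 1 → ‖Q x y‖ ≤ C * ‖y‖ := by
  refine ⟨‖Q‖ + 1, by positivity, fun x y hx => ?_⟩
  have h := (Q x).le_of_opNorm_le_of_le (Q.le_of_opNorm_le_of_le le_rfl hx) (le_refl ‖y‖)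
  linarith [norm_nonneg y]

variable (k X) in
/-- Every operator on the dual of the bounded continuous functions that factors through `V`
induces a negligible form. -/
def FactorsNegligibly (V : Type*) [NormedAddCommGroup V] [NormedSpace k V] : Prop :=
  ∀ (ι : StrongDual k (X →ᵇ k) →L[k] V) (Q : (X →ᵇ k) →L[k] StrongDual k V),
    Negligible fun f μ => Q f (ι μ)

theorem FactorsNegligibly.of_equiv {V W : Type*} [NormedAddCommGroup V] [NormedSpace k V]
    [NormedAddCommGroup W] [NormedSpace k W] (e : V ≃ₗᵢ[k] W) (h : FactorsNegligibly k X W) :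
    FactorsNegligibly k X V := by
  intro ι Q
  have := h ((e.toContinuousLinearEquiv : V →L[k] W).comp ι)
    (dualPrecomp Q (e.symm.toContinuousLinearEquiv : W →L[k] V))
  convert this using 3 with f μ
  change Q f (ι μ) = Q f (e.symm (e (ι μ)))
  rw [e.symm_apply_apply]

variable {I : Type u} {W : I → Type v} [∀ i, NormedAddCommGroup (W i)]
  [∀ i, NormedSpace k (W i)]

theorem lp_single_mem_completedSum [DecidableEq I] (i : I) (x : W i) :
    (lp.single ∞ i x : BoundedProduct W) ∈ CompletedSum k W := by
  intro ε hε
  refine (Set.finite_singleton i).subset fun j hj => ?_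
  by_contra hne
  have h : ε ≤ ‖(lp.single ∞ i x : BoundedProduct W) j‖ := hj
  rw [lp.single_apply_ne ∞ i x hne, norm_zero] at h
  linarith

variable (k) in
/-- The inclusion of a summand into the completed direct sum. -/
noncomputable def completedSumSingle [DecidableEq I] (i : I) : W i →L[k] CompletedSum k W :=
  (lp.singleContinuousLinearMap k W ∞ i).codRestrict _ (lp_single_mem_completedSum i)

variable (k) in
/-- The projection of the completed direct sum onto a summand. -/
noncomputable def completedSumEval (i : I) : CompletedSum k W →L[k] W i :=
  (lp.evalCLM k W ∞ i).comp (CompletedSum k W).subtypeL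

theorem hasSum_completedSumSingle [DecidableEq I] (w : CompletedSum k W) :
    HasSum (fun i => completedSumSingle k i (completedSumEval k i w)) w := by
  rw [HasSum, SummationFilter.unconditional_filter, Metric.tendsto_nhds]
  intro ε hε
  have hfin := w.2 (ε / 2) (half_pos hε)
  filter_upwards [eventually_ge_atTop hfin.toFinset] with s hs
  rw [dist_eq_norm]
  refine lt_of_le_of_lt ?_ (half_lt_self hε)
  change ‖((∑ j ∈ s, completedSumSingle k j (completedSumEval k j w) - w : CompletedSum k W) :
    BoundedProduct W)‖ ≤ ε / 2
  rw [Submodule.coe_sub, Submodule.coe_sum]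
  refine lp.norm_le_of_forall_le (half_pos hε).le fun i => ?_
  have hval : (∑ j ∈ s, (completedSumSingle k j (completedSumEval k j w) : BoundedProduct W)) i =
      if i ∈ s then (w : BoundedProduct W) i else 0 := by
    rw [lp.coeFn_sum, Finset.sum_apply]
    change ∑ j ∈ s, (lp.single ∞ j ((w : BoundedProduct W) j) : BoundedProduct W) i = _
    simp only [lp.coeFn_single]
    exact Finset.sum_pi_single i _ s
  rw [lp.coeFn_sub, Pi.sub_apply, hval]
  split_ifs with hi
  · simpa using (half_pos hε).le
  · rw [zero_sub, norm_neg]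
    by_contra! hlt
    exact hi (hs (hfin.mem_toFinset.mpr hlt.le))

variable [IsUltrametricDist k]

theorem factorsNegligibly_pi (hsph : ¬ SphericallyComplete k) (hX : HasVanishingClopens X)
    (n : ℕ) : FactorsNegligibly k X (Fin n → k) := by
  intro ι Q
  refine negligible_of_hasSum (Bi := fun i f μ => Q f (Pi.single i 1) * ι μ i) (fun f μ => ?_)
    (fun i => ?_) fun U hU hne ε _ => ⟨U, subset_rfl, hU, hne, Finset.univ, by simp⟩
  · have : Q f (ι μ) = ∑ i, Q f (Pi.single i 1) * ι μ i := by
      conv_lhs => rw [pi_eq_sum_univ' (ι μ)]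
      rw [map_sum]
      refine Finset.sum_congr rfl fun i _ => ?_
      rw [map_smul, smul_eq_mul, mul_comm]
    rw [this]
    exact hasSum_fintype _
  · exact negligible_rank_one hsph hX (Q.flip (Pi.single i 1))
      ((ContinuousLinearMap.proj i).comp ι)

variable [CompleteSpace k]

/-- Multiplying `w` by scalar families reduces this to `ℓ^∞(I)`, evaluated at the constant family 1.
-/
theorem hasSum_apply_lp_single [DecidableEq I] (hsph : ¬ SphericallyComplete k)
    (hI : ¬ CardinalMeasurable ℵ₁ I) (φ : StrongDual k (BoundedProduct W))
    (w : BoundedProduct W) : HasSum (fun i => φ (lp.single ∞ i (w i))) (φ w) := by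
  have h := hasSum_apply_singleton hsph (eq_zero_of_vanish_on_singletons hsph hI)
    (φ.comp (lpPullbackSMul k id w)) (lpIndicator k Set.univ)
  have h1 : lpPullbackSMul k id w (lpIndicator k Set.univ) = w := by
    ext i
    simp
  have h2 (i : I) : lpPullbackSMul k id w (lpIndicator k {i}) = lp.single ∞ i (w i) := by
    ext j
    by_cases hj : j = i
    · subst hj; simp
    · simp [hj]
  simpa [h1, h2] using h

theorem factorsNegligibly_boundedProduct (hsph : ¬ SphericallyComplete k)
    (hX : HasVanishingClopens X) (hI : ¬ CardinalMeasurable ℵ₁ I)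
    (hW : ∀ i, FactorsNegligibly k X (W i)) : FactorsNegligibly k X (BoundedProduct W) := by
  classical
  intro ι Q
  let S (i : I) : W i →L[k] BoundedProduct W := lp.singleContinuousLinearMap k W ∞ i
  let T (i : I) : StrongDual k (X →ᵇ k) →L[k] W i := (lp.evalCLM k W ∞ i).comp ι
  let B (i : I) : (X →ᵇ k) →L[k] StrongDual k (StrongDual k (X →ᵇ k)) :=
    dualPrecomp Q ((S i).comp (T i))
  refine negligible_of_hasSum (Bi := fun i f μ => B i f μ)
    (fun f μ => hasSum_apply_lp_single hsph hI (Q f) (ι μ))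
    (fun i => hW i (T i) (dualPrecomp Q (S i)))
    (exists_small_off_finset_left hsph hX B fun f δ hδ => ?_)
  -- Since the product contains all bounded families, the coordinates `ι (m i) i`, taken from
  -- different functionals, glue to one element `w`. Summability of `Q f` along `w` leaves finitely
  -- many bad indices.
  choose! m hm hmδ using fun i (hi : i ∈ {i | ∃ μ, ‖μ‖ ≤ 1 ∧ δ < ‖B i f μ‖}) => hi
  let w : BoundedProduct W :=
    ⟨fun i => if i ∈ {i | ∃ μ, ‖μ‖ ≤ 1 ∧ δ < ‖B i f μ‖} then ι (m i) i else 0,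
      memℓp_infty ⟨‖ι‖, by
        rintro _ ⟨i, rfl⟩
        dsimp only
        split_ifs with h
        · refine (lp.norm_apply_le_norm ENNReal.top_ne_zero _ i).trans ?_
          simpa using ι.le_of_opNorm_le_of_le le_rfl (hm i h)
        · exact norm_zero.trans_le (norm_nonneg ι)⟩⟩
  have hlim := (hasSum_apply_lp_single hsph hI (Q f) w).summable.tendsto_cofinite_zero
  have hfin := Metric.tendsto_nhds.mp hlim δ hδ
  rw [Filter.eventually_cofinite] at hfin
  refine hfin.subset fun i hi => ?_
  have hwi : w i = ι (m i) i := if_pos hi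
  change ¬ dist (Q f (lp.single ∞ i (w i))) 0 < δ
  rw [hwi, dist_zero_right, not_lt]
  exact (hmδ i hi).le

/-- Here `ι μ` is the norm limit of its finite parts, and its coordinates tend to zero, which bounds
`B i f μ` uniformly in `f`. -/
theorem factorsNegligibly_completedSum (hsph : ¬ SphericallyComplete k)
    (hX : HasClopenBases X) (hW : ∀ i, FactorsNegligibly k X (W i)) :
    FactorsNegligibly k X (CompletedSum k W) := by
  classical
  intro ι Q
  let S (i : I) : W i →L[k] CompletedSum k W := completedSumSingle k i
  let T (i : I) : StrongDual k (X →ᵇ k) →L[k] W i := (completedSumEval k i).comp ι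
  let B (i : I) : (X →ᵇ k) →L[k] StrongDual k (StrongDual k (X →ᵇ k)) :=
    dualPrecomp Q ((S i).comp (T i))
  refine negligible_of_hasSum (Bi := fun i f μ => B i f μ)
    (fun f μ => (hasSum_completedSumSingle (ι μ)).mapL (Q f))
    (fun i => hW i (T i) (dualPrecomp Q (S i)))
    (exists_small_off_finset_right hsph hX B fun μ δ hδ => ?_)
  obtain ⟨C, hC, hQ⟩ := exists_pos_bound_of_norm_le_one Q
  refine ((ι μ).2 _ (div_pos hδ hC)).subset ?_
  rintro i ⟨f, hf, hlt⟩
  change δ / C ≤ ‖(ι μ : BoundedProduct W) i‖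
  have hS : ‖S i (T i μ)‖ = ‖(ι μ : BoundedProduct W) i‖ :=
    lp.norm_single (p := ∞) (by simp) i ((ι μ : BoundedProduct W) i)
  rw [div_le_iff₀' hC, ← hS]
  exact hlt.le.trans (hQ f _ hf)

end Factorization

/-! ### Clopen subsets of `ℚ`. -/

section Rationals

theorem isClopen_rat_preimage_Ioo {a b : ℝ} (ha : Irrational a) (hb : Irrational b) :
    IsClopen ((fun t : ℚ => (t : ℝ)) ⁻¹' Set.Ioo a b) := by
  refine ⟨?_, isOpen_Ioo.preimage Rat.continuous_coe_real⟩
  have : (fun t : ℚ => (t : ℝ)) ⁻¹' Set.Ioo a b = (fun t : ℚ => (t : ℝ)) ⁻¹' Set.Icc a b := by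
    ext t
    simp only [Set.mem_preimage, Set.mem_Ioo, Set.mem_Icc]
    refine ⟨fun h => ⟨h.1.le, h.2.le⟩, fun h => ⟨h.1.lt_of_ne fun e => ha ⟨t, e.symm⟩,
      h.2.lt_of_ne fun e => hb ⟨t, e⟩⟩⟩
  rw [this]
  exact isClosed_Icc.preimage Rat.continuous_coe_real

theorem irrational_sqrt_two_div (n : ℕ) : Irrational (√2 / ((n : ℝ) + 1)) := by
  exact_mod_cast irrational_sqrt_two.div_natCast n.succ_ne_zero

theorem hasClopenBases_rat : HasClopenBases ℚ := by
  intro U hU q hq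
  have hpos (n : ℕ) : 0 < √2 / ((n : ℝ) + 1) := by positivity
  refine ⟨fun n => U ∩ (fun t : ℚ => (t : ℝ)) ⁻¹'
    Set.Ioo ((q : ℝ) - √2 / ((n : ℝ) + 1)) ((q : ℝ) + √2 / ((n : ℝ) + 1)), ?_, ?_, ?_⟩
  · intro m n hmn
    have : √2 / ((n : ℝ) + 1) ≤ √2 / ((m : ℝ) + 1) := by gcongr
    exact Set.inter_subset_inter_right _ (Set.preimage_mono
      (Set.Ioo_subset_Ioo (by linarith) (by linarith)))
  · intro n
    refine ⟨hU.inter (isClopen_rat_preimage_Ioo ((irrational_sqrt_two_div n).ratCast_sub q)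
      ((irrational_sqrt_two_div n).ratCast_add q)), ⟨hq, ?_, ?_⟩, Set.inter_subset_left⟩
    · linarith [hpos n]
    · linarith [hpos n]
  · intro N hN
    obtain ⟨δ, hδ, hball⟩ := Metric.mem_nhds_iff.mp hN
    have hlim : Tendsto (fun n : ℕ => √2 / ((n : ℝ) + 1)) atTop (𝓝 0) := by
      simpa [div_eq_mul_inv] using
        (tendsto_one_div_add_atTop_nhds_zero_nat (𝕜 := ℝ)).const_mul √2
    obtain ⟨n, hn⟩ := ((tendsto_order.mp hlim).2 δ hδ).exists
    refine ⟨n, fun t ht => hball ?_⟩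
    rw [Metric.mem_ball, Rat.dist_eq, abs_lt]
    obtain ⟨-, h1, h2⟩ := ht
    constructor <;> linarith

theorem hasVanishingClopens_rat : HasVanishingClopens ℚ := by
  intro U hU ⟨q, hq⟩
  obtain ⟨δ, hδ, hball⟩ := Metric.mem_nhds_iff.mp (hU.isOpen.mem_nhds hq)
  -- The clopen sets shrink to an irrational point `s`, which is missing from `ℚ`. The length `c` is
  -- rational so that the right endpoints are irrational too.
  obtain ⟨s, hs, hqs, hsδ⟩ : ∃ s : ℝ, Irrational s ∧ (q : ℝ) < s ∧ s < q + δ :=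
    exists_irrational_btwn (by linarith)
  obtain ⟨c, hc0, hcδ⟩ : ∃ c : ℚ, (0 : ℝ) < c ∧ (c : ℝ) < q + δ - s :=
    exists_rat_btwn (by linarith)
  have hpos (n : ℕ) : 0 < (c : ℝ) / ((n : ℝ) + 1) := by positivity
  have hle (m n : ℕ) (h : m ≤ n) : (c : ℝ) / ((n : ℝ) + 1) ≤ (c : ℝ) / ((m : ℝ) + 1) := by
    gcongr
  refine ⟨fun n => (fun t : ℚ => (t : ℝ)) ⁻¹' Set.Ioo s (s + (c : ℝ) / ((n : ℝ) + 1)),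
    ?_, ?_, ?_⟩
  · intro m n hmn
    exact Set.preimage_mono (Set.Ioo_subset_Ioo_right (by linarith [hle m n hmn]))
  · intro n
    refine ⟨isClopen_rat_preimage_Ioo hs ?_, ?_, ?_⟩
    · exact_mod_cast hs.add_ratCast (c / ((n : ℚ) + 1))
    · obtain ⟨t, h1, h2⟩ := exists_rat_btwn (lt_add_of_pos_right s (hpos n))
      exact ⟨t, h1, h2⟩
    · rintro t ⟨h1, h2⟩
      refine hball ?_
      have := hle 0 n n.zero_le
      simp only [Nat.cast_zero, zero_add, div_one] at this
      rw [Metric.mem_ball, Rat.dist_eq, abs_lt]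
      constructor <;> linarith
  · intro t
    by_contra! h
    have hlim : Tendsto (fun n : ℕ => s + (c : ℝ) / ((n : ℝ) + 1)) atTop (𝓝 s) := by
      simpa [div_eq_mul_inv] using
        ((tendsto_one_div_add_atTop_nhds_zero_nat (𝕜 := ℝ)).const_mul (c : ℝ)).const_add s
    exact absurd (ge_of_tendsto' hlim fun n => (h n).2.le) (not_le.mpr (h 0).1)

end Rationals

/-! ### Induction on the hierarchy, and the evaluation form. -/

theorem ReidHierarchy.factorsNegligibly {k : Type u} [NontriviallyNormedField k]
    [CompleteSpace k] [IsUltrametricDist k] {κ : WithTop Cardinal.{u}}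
    (hmeas : NonMeasurabilityCondition κ) (hsph : ¬ SphericallyComplete k)
    {X : Type*} [TopologicalSpace X] (hX : HasVanishingClopens X) (hX' : HasClopenBases X)
    {α : Ordinal.{u}} {V : Type u} [NormedAddCommGroup V] [NormedSpace k V]
    (h : ReidHierarchy k κ α V) : FactorsNegligibly k X V := by
  induction h with
  | zero V n e => exact (factorsNegligibly_pi hsph hX n).of_equiv e
  | prod α V hα I hI W β hβ hW e ih =>
    exact (factorsNegligibly_boundedProduct hsph hX (hmeas I hI) ih).of_equiv e
  | sum α V hα I hI W β hβ hW e ih =>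
    exact (factorsNegligibly_completedSum hsph hX' ih).of_equiv e

theorem not_factorsNegligibly_strongDual (k : Type v) [NontriviallyNormedField k] (X : Type*)
    [TopologicalSpace X] [Nonempty X] : ¬ FactorsNegligibly k X (StrongDual k (X →ᵇ k)) := by
  intro h
  obtain ⟨V, -, hV, ⟨q, hq⟩, hsmall⟩ := h (ContinuousLinearMap.id k _)
    (NormedSpace.inclusionInDoubleDual k (X →ᵇ k)) Set.univ isClopen_univ Set.univ_nonempty
    (1 / 2) one_half_pos
  classical
  let f : X →ᵇ k := BoundedContinuousFunction.ofNormedAddCommGroup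
    (LocallyConstant.charFn k hV) (LocallyConstant.continuous _) 1 fun t => by
      by_cases ht : t ∈ V <;> simp [LocallyConstant.coe_charFn, ht]
  have hfV (t : X) : f t = V.indicator (1 : X → k) t := by
    change LocallyConstant.charFn k hV t = _
    rw [LocallyConstant.coe_charFn]
  have := hsmall f ⟨fun t => by rw [hfV]; by_cases ht : t ∈ V <;> simp [ht],
    fun t ht => by simp [hfV, ht]⟩ (pointEvaluation k q) fun g C _ hg => hg q hq
  change ‖f q‖ ≤ 1 / 2 at this
  rw [hfV, Set.indicator_of_mem hq, Pi.one_apply, norm_one] at this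
  norm_num at this

theorem mainTheorem6 (k : Type u) [NontriviallyNormedField k] [CompleteSpace k]
    [IsUltrametricDist k] (hdense : Dense (Set.range fun x : k => ‖x‖₊))
    (κ : WithTop Cardinal.{u}) (hκ : ((ℵ₀ : Cardinal.{u}) : WithTop Cardinal.{u}) ≤ κ)
    (hmeas : NonMeasurabilityCondition κ) (hsph : ¬ SphericallyComplete k) :
    ¬ ReidClass k κ (StrongDual k (ℚ →ᵇ k)) := by
  rintro ⟨α, h⟩
  exact not_factorsNegligibly_strongDual k ℚ
    (h.factorsNegligibly hmeas hsph hasVanishingClopens_rat hasClopenBases_rat)
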